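/- Let $M=\mathbb R^2_{x,y}\times S^1_\theta$, $S^1=\mathbb R/2\pi\mathbb Z$, with the vector fields $X_1=\cos\theta\,\partial_x+\sin\theta\,\partial_y$ and $X_2=\partial_\theta$, and let $t_1>0$ and $q_0,q_1\in M$. An admissible control is a function $u\in L_2[0,t_1]$; a corresponding trajectory is an absolutely continuous curve $q:[0,t_1]\to M$ with $\dot q=X_1(q)+uX_2(q)$ for almost all $t$ (that is, $\dot x=\cos\theta$, $\dot y=\sin\theta$, $\dot\theta=u$). The attainable set $\mathcal A_{q_0}(t_1)$ is the set of endpoints $q(t_1)$ of all such trajectories with $q(0)=q_0$. Euler's elastic problem is to minimize $$J=\tfrac12\int_0^{t_1}u^2(t)\,dt$$ over all admissible controls $u$ and corresponding trajectories $q$ with $q(0)=q_0$ and $q(t_1)=q_1$. A minimizing pair $(u,q)$ is called an optimal solution, $u$ an optimal control and $q$ an optimal trajectory. For $\lambda\in T^*M$ over $q\in M$, and $u,\nu\in\mathbb R$, put $h_u^\nu(\lambda)=\langle\lambda,X_1(q)+uX_2(q)\rangle+\frac{\nu}{2}u^2$, and let $\vec h_u^\nu$ be the Hamiltonian vector field of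 $h_u^\nu$ on $T^*M$ (in canonical coordinates $\dot q=\partial h_u^\nu/\partial p$, $\dot p=-\partial h_u^\nu/\partial q$). An admissible control $u$ with a corresponding trajectory $q$ satisfies the Pontryagin Maximum Principle (PMP) with multiplier $\nu\le 0$ if there is an absolutely continuous curve $\lambda_t\in T^*M$, $t\in[0,t_1]$, lying over $q(t)$, such that for almost all $t\in[0,t_1]$ $$\dot\lambda_t=\vec h^{\nu}_{u(t)}(\lambda_t),\qquad h^\nu_{u(t)}(\lambda_t)=\max_{v\in\mathbb R}h^\nu_v(\lambda_t),\qquad (\nu,\lambda_t)\ne 0 .$$ An admissible control $u$ is an abnormal extremal control if, with some corresponding trajectory, it satisfies the PMP with $\nu=0$. **Theorem.** Let $q_1\in\mathcal A_{q_0}(t_1)$. Then: 1. There exists an optimal control $u\in L_2[0,t_1]$ for Euler's elastic problem. 2. Every optimal solution $(u,q)$ satisfies the PMP with some multiplier $\nu\le 0$. 3. Every abnormal extremal control is zero almost everywhere on $[0,t_1]$. 4. Every optimal control is essentially bounded: $u\in L_\infty[0,t_1]$. 5. Every optimal trajectory is Lipschitz on $[0,t_1]$. -/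

import Mathlib

open MeasureTheory Set

noncomputable section

namespace EulerElastica

/-- The state space `M = ℝ²_{x,y} × S¹_θ`; a state is `q = (x, y, θ)` with `θ ∈ ℝ / 2πℤ`. -/
abbrev State : Type := ℝ × ℝ × Real.Angle

/-- Tangent vectors to `M`, written in the global frame `∂/∂x, ∂/∂y, ∂/∂θ`. -/
abbrev Tangent : Type := ℝ × ℝ × ℝ

/-- Covectors on `M`, written in the global coframe `dx, dy, dθ`. -/
abbrev Covector : Type := ℝ × ℝ × ℝ

/-- The cotangent bundle `T*M`, trivialised by the coframe `dx, dy, dθ`; a point is `(q, p)`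
with `q ∈ M` and `p ∈ T_q*M`, and the canonical projection is `Prod.fst`. -/
abbrev Cotangent : Type := State × Covector

/-- The pairing `⟨p, v⟩` of a covector and a tangent vector. -/
def pairing (p : Covector) (v : Tangent) : ℝ :=
  p.1 * v.1 + p.2.1 * v.2.1 + p.2.2 * v.2.2

/-- The drift `X₁ = cos θ ∂/∂x + sin θ ∂/∂y`. -/
def X₁ (q : State) : Tangent := (q.2.2.cos, q.2.2.sin, 0)

/-- The controlled field `X₂ = ∂/∂θ`. -/
def X₂ (_q : State) : Tangent := (0, 0, 1)

/-- The curve `q` in `M` has velocity `v` at time `t`. The angular component is differentiated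
in the chart `θ' ↦ θ' - θ(t) ∈ (-π, π]` of the circle centred at `θ(t)`. -/
def HasVelocityAt (q : ℝ → State) (v : Tangent) (t : ℝ) : Prop :=
  HasDerivAt (fun s => (q s).1) v.1 t ∧
  HasDerivAt (fun s => (q s).2.1) v.2.1 t ∧
  HasDerivAt (fun s => ((q s).2.2 - (q t).2.2).toReal) v.2.2 t

/-- Admissible controls: `u ∈ L₂[0, t₁]`. -/
def IsAdmissibleControl (t₁ : ℝ) (u : ℝ → ℝ) : Prop :=
  MemLp u 2 (volume.restrict (Icc 0 t₁))

/-- `q` is an admissible trajectory on `[0, t₁]` for the admissible control `u`: it is absolutely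
continuous and `q' = X₁(q) + u X₂(q)` almost everywhere on `[0, t₁]`. -/
def IsTrajectory (t₁ : ℝ) (u : ℝ → ℝ) (q : ℝ → State) : Prop :=
  IsAdmissibleControl t₁ u ∧
  AbsolutelyContinuousOnInterval q 0 t₁ ∧
  ∀ᵐ t ∂(volume.restrict (Icc 0 t₁)), HasVelocityAt q (X₁ (q t) + u t • X₂ (q t)) t

/-- The control `u` and the trajectory `q` satisfy the boundary conditions
`q(0) = q₀`, `q(t₁) = q₁`. -/
def Connects (t₁ : ℝ) (q₀ q₁ : State) (u : ℝ → ℝ) (q : ℝ → State) : Prop :=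
  IsTrajectory t₁ u q ∧ q 0 = q₀ ∧ q t₁ = q₁

/-- The attainable set from `q₀` for (exact) time `t₁`. -/
def attainableSet (q₀ : State) (t₁ : ℝ) : Set State :=
  {q₁ | ∃ u q, Connects t₁ q₀ q₁ u q}

/-- The elastic energy `J = ½ ∫₀^{t₁} u² dt`. -/
def energy (t₁ : ℝ) (u : ℝ → ℝ) : ℝ := (1 / 2) * ∫ t in (0)..t₁, u t ^ 2

/-- `(u, q)` is an optimal solution of Euler's elastic problem: an optimal control together with
the corresponding optimal trajectory. -/
def IsOptimalSolution (t₁ : ℝ) (q₀ q₁ : State) (u : ℝ → ℝ) (q : ℝ → State) : Prop :=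
  Connects t₁ q₀ q₁ u q ∧ ∀ u' q', Connects t₁ q₀ q₁ u' q' → energy t₁ u ≤ energy t₁ u'

/-- `u` is an optimal control of Euler's elastic problem. -/
def IsOptimalControl (t₁ : ℝ) (q₀ q₁ : State) (u : ℝ → ℝ) : Prop :=
  ∃ q, IsOptimalSolution t₁ q₀ q₁ u q

/-- The control-dependent Hamiltonian `h_u^ν(λ) = ⟨λ, X₁ + u X₂⟩ + (ν/2) u²` on `T*M`. -/
def hamiltonian (ν u : ℝ) (l : Cotangent) : ℝ :=
  pairing l.2 (X₁ l.1 + u • X₂ l.1) + ν / 2 * u ^ 2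

/-- The horizontal part `∂H/∂p` of the Hamiltonian vector field of `H` in the canonical
coordinates of `T*M`. -/
def hamHorizontal (H : Cotangent → ℝ) (l : Cotangent) : Tangent :=
  (deriv (fun s : ℝ => H (l.1, l.2 + (s, 0, 0))) 0,
   deriv (fun s : ℝ => H (l.1, l.2 + (0, s, 0))) 0,
   deriv (fun s : ℝ => H (l.1, l.2 + (0, 0, s))) 0)

/-- The vertical part `-∂H/∂q` of the Hamiltonian vector field of `H` in the canonical
coordinates of `T*M`. -/
def hamVertical (H : Cotangent → ℝ) (l : Cotangent) : Covector :=
  (-deriv (fun s : ℝ => H (l.1 + (s, 0, 0), l.2)) 0,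
   -deriv (fun s : ℝ => H (l.1 + (0, s, 0), l.2)) 0,
   -deriv (fun s : ℝ => H (l.1 + (0, 0, (s : Real.Angle)), l.2)) 0)

/-- The curve `l` in `T*M` satisfies `l' = (Hamiltonian vector field of H)(l)` at time `t`. -/
def HamiltonEquationAt (H : Cotangent → ℝ) (l : ℝ → Cotangent) (t : ℝ) : Prop :=
  HasVelocityAt (fun s => (l s).1) (hamHorizontal H (l t)) t ∧
  HasDerivAt (fun s => (l s).2) (hamVertical H (l t)) t

/-- The conditions of the Pontryagin Maximum Principle for the pair `(u, q)` with the
multiplier `ν ≤ 0`: there is an absolutely continuous lift `l` of `q` to `T*M` such that almost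
everywhere on `[0, t₁]` the Hamiltonian system, the maximality condition and the nontriviality
condition hold. -/
def IsExtremal (t₁ ν : ℝ) (u : ℝ → ℝ) (q : ℝ → State) : Prop :=
  IsTrajectory t₁ u q ∧ ν ≤ 0 ∧
  ∃ l : ℝ → Cotangent,
    AbsolutelyContinuousOnInterval l 0 t₁ ∧
    (∀ t ∈ Icc 0 t₁, (l t).1 = q t) ∧
    ∀ᵐ t ∂(volume.restrict (Icc 0 t₁)),
      HamiltonEquationAt (hamiltonian ν (u t)) l t ∧
      (∀ v : ℝ, hamiltonian ν v (l t) ≤ hamiltonian ν (u t) (l t)) ∧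
      (ν, (l t).2) ≠ 0

/-- `(u, q)` satisfies the Pontryagin Maximum Principle. -/
def SatisfiesPMP (t₁ : ℝ) (u : ℝ → ℝ) (q : ℝ → State) : Prop :=
  ∃ ν : ℝ, IsExtremal t₁ ν u q

/-- `u` is an abnormal extremal control: it satisfies, with some trajectory, the conditions of the
maximum principle with `ν = 0`. -/
def IsAbnormalExtremalControl (t₁ : ℝ) (u : ℝ → ℝ) : Prop :=
  ∃ q, IsExtremal t₁ 0 u q

end EulerElastica

end

/-!
# Optimal controls in Euler's elastic problem

A trajectory is obtained from its control by two quadratures: the angle is a primitive of `u`,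
lifted to `ℝ`, and the plane coordinates are the integrals of its cosine and sine
(`isTrajectory_trajectoryFrom`, `IsTrajectory.eqOn_trajectoryFrom`). Uniqueness rests on the fact
that an absolutely continuous function with almost everywhere zero derivative is constant, applied
to the cosine and the sine of the difference of two angular components. The problem therefore
becomes the minimisation of `‖u‖² / 2` on the Hilbert space `L²[0, t₁]` under three scalar
constraints: the values of `∫ cos θ`, `∫ sin θ`, and of the final angle modulo `2π`.

* Existence is the direct method. The value at `t` of the primitive of `u` is the inner product of
  `u` with an indicator function, so weak convergence of controls gives pointwise convergence of
  the angles, and dominated convergence gives convergence of the endpoints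
  (`tendsto_trajectoryFrom`). The admissible set is thus weakly sequentially closed, and
  `exists_norm_le_of_weakly_seqClosed` applies.
* The maximum principle is the Lagrange multiplier rule (`exists_multipliers`). The constraints are
  strictly differentiable on `L²` because `cos` and `sin` have Lipschitz derivatives; an integration
  by parts (`inner_tailIntegral`) gives the gradient of `∫ f(θ)` as `s ↦ ∫ₛ^{t₁} f'(θ)`. The
  multipliers `a, b, c, ν` of the constraints and the energy produce the covector
  `(a, b, c + ∫ₜ^{t₁} (b cos θ - a sin θ))`, and the vanishing of the Lagrangian gradient is
  `p₃ + ν u = 0`. As the Hamiltonian is a concave quadratic polynomial in the control, this is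
  the maximality condition.
* For `ν = 0` maximality forces `p₃ = 0`. Then `p₁ sin θ = p₂ cos θ` with a nonzero constant vector
  `(p₁, p₂)`, and differentiating once more gives `u = 0`
  (`IsAbnormalExtremalControl.ae_eq_zero`).
* For `ν < 0` the control equals the continuous function `-p₃ / ν` almost everywhere. In both cases
  it is essentially bounded, so the quadratures defining the trajectory are Lipschitz.
-/

noncomputable section

namespace EulerElastica

open Filter Topology
open scoped NNReal

/-! ### Curves in the circle and absolutely continuous curves -/

theorem exists_coe_eq_abs_eq_norm (θ : Real.Angle) :
    ∃ x : ℝ, (x : Real.Angle) = θ ∧ |x| = ‖θ‖ := by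
  induction θ using Real.Angle.induction_on with
  | _ x =>
    refine ⟨x - round ((2 * Real.pi)⁻¹ * x) * (2 * Real.pi), ?_, ?_⟩
    · rw [Real.Angle.angle_eq_iff_two_pi_dvd_sub]
      exact ⟨-round ((2 * Real.pi)⁻¹ * x), by push_cast; ring⟩
    · exact (AddCircle.norm_eq (2 * Real.pi)).symm

theorem norm_coe_le (x : ℝ) : ‖(x : Real.Angle)‖ ≤ |x| :=
  (QuotientAddGroup.norm_mk_le_norm : _ ≤ ‖x‖)

theorem dist_coe_le (x y : ℝ) : dist (x : Real.Angle) (y : Real.Angle) ≤ dist x y := by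
  rw [dist_eq_norm, ← Real.Angle.coe_sub, Real.dist_eq]
  exact norm_coe_le _

theorem lipschitzWith_coe : LipschitzWith 1 (fun x : ℝ => (x : Real.Angle)) :=
  LipschitzWith.mk_one dist_coe_le

theorem lipschitzWith_real_cos : LipschitzWith 1 Real.cos :=
  lipschitzWith_of_nnnorm_deriv_le Real.differentiable_cos fun x => by
    rw [← NNReal.coe_le_coe, coe_nnnorm, Real.deriv_cos, norm_neg]
    exact Real.abs_sin_le_one x

theorem lipschitzWith_real_sin : LipschitzWith 1 Real.sin :=
  lipschitzWith_of_nnnorm_deriv_le Real.differentiable_sin fun x => by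
    rw [← NNReal.coe_le_coe, coe_nnnorm, Real.deriv_sin]
    exact Real.abs_cos_le_one x

theorem lipschitzWith_angle_of_lift {f : Real.Angle → ℝ}
    (hf : LipschitzWith 1 (fun x : ℝ => f x)) : LipschitzWith 1 f := by
  refine LipschitzWith.mk_one fun θ ψ => ?_
  obtain ⟨x, hx, hxn⟩ := exists_coe_eq_abs_eq_norm (θ - ψ)
  induction ψ using Real.Angle.induction_on with
  | _ y =>
    obtain rfl : θ = ((x + y : ℝ) : Real.Angle) := by rw [Real.Angle.coe_add, hx]; abel
    calc dist (f ((x + y : ℝ) : Real.Angle)) (f y) ≤ dist (x + y) y := by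
          simpa using hf.dist_le_mul (x + y) y
      _ = _ := by rw [dist_eq_norm, dist_eq_norm (_ : Real.Angle), ← hxn]; simp

theorem lipschitzWith_angle_cos : LipschitzWith 1 Real.Angle.cos :=
  lipschitzWith_angle_of_lift (by simpa using lipschitzWith_real_cos)

theorem lipschitzWith_angle_sin : LipschitzWith 1 Real.Angle.sin :=
  lipschitzWith_angle_of_lift (by simpa using lipschitzWith_real_sin)

theorem _root_.LipschitzWith.comp_absolutelyContinuousOnInterval {X Y : Type*}
    [PseudoMetricSpace X] [PseudoMetricSpace Y] {K : ℝ≥0} {g : X → Y} {f : ℝ → X} {a b : ℝ}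
    (hg : LipschitzWith K g) (hf : AbsolutelyContinuousOnInterval f a b) :
    AbsolutelyContinuousOnInterval (fun t => g (f t)) a b := by
  refine squeeze_zero (fun E => Finset.sum_nonneg fun _ _ => dist_nonneg) (fun E => ?_)
    (by simpa using Tendsto.const_mul (K : ℝ) hf)
  rw [Finset.mul_sum]
  exact Finset.sum_le_sum fun _ _ => hg.dist_le_mul _ _

theorem absolutelyContinuousOnInterval_prodMk {X Y : Type*}
    [PseudoMetricSpace X] [PseudoMetricSpace Y] {f : ℝ → X} {g : ℝ → Y} {a b : ℝ}
    (hf : AbsolutelyContinuousOnInterval f a b) (hg : AbsolutelyContinuousOnInterval g a b) :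
    AbsolutelyContinuousOnInterval (fun t => (f t, g t)) a b := by
  refine squeeze_zero (fun E => Finset.sum_nonneg fun _ _ => dist_nonneg) (fun E => ?_)
    (by simpa using Tendsto.add hf hg)
  rw [← Finset.sum_add_distrib]
  refine Finset.sum_le_sum fun _ _ => ?_
  rw [Prod.dist_eq]
  exact max_le_add_of_nonneg dist_nonneg dist_nonneg

theorem absolutelyContinuousOnInterval_fst {X Y : Type*}
    [PseudoMetricSpace X] [PseudoMetricSpace Y] {f : ℝ → X × Y} {a b : ℝ}
    (hf : AbsolutelyContinuousOnInterval f a b) :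
    AbsolutelyContinuousOnInterval (fun t => (f t).1) a b :=
  (LipschitzWith.prod_fst (α := X) (β := Y)).comp_absolutelyContinuousOnInterval hf

theorem absolutelyContinuousOnInterval_snd {X Y : Type*}
    [PseudoMetricSpace X] [PseudoMetricSpace Y] {f : ℝ → X × Y} {a b : ℝ}
    (hf : AbsolutelyContinuousOnInterval f a b) :
    AbsolutelyContinuousOnInterval (fun t => (f t).2) a b :=
  (LipschitzWith.prod_snd (α := X) (β := Y)).comp_absolutelyContinuousOnInterval hf

theorem absolutelyContinuousOnInterval_const {X : Type*} [PseudoMetricSpace X] (x : X) (a b : ℝ) :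
    AbsolutelyContinuousOnInterval (fun _ => x) a b :=
  (LipschitzWith.const x).lipschitzOnWith.absolutelyContinuousOnInterval

theorem hasDerivAt_fst_comp {E F : Type*} [NormedAddCommGroup E] [NormedSpace ℝ E]
    [NormedAddCommGroup F] [NormedSpace ℝ F] {f : ℝ → E × F} {f' : E × F} {t : ℝ}
    (h : HasDerivAt f f' t) : HasDerivAt (fun s => (f s).1) f'.1 t :=
  (ContinuousLinearMap.fst ℝ E F).hasFDerivAt.comp_hasDerivAt t h

theorem hasDerivAt_snd_comp {E F : Type*} [NormedAddCommGroup E] [NormedSpace ℝ E]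
    [NormedAddCommGroup F] [NormedSpace ℝ F] {f : ℝ → E × F} {f' : E × F} {t : ℝ}
    (h : HasDerivAt f f' t) : HasDerivAt (fun s => (f s).2) f'.2 t :=
  (ContinuousLinearMap.snd ℝ E F).hasFDerivAt.comp_hasDerivAt t h

/-- An absolutely continuous real function is determined by its initial value and its almost
everywhere derivative. -/
theorem eqOn_of_ae_hasDerivAt {f g : ℝ → ℝ} {T : ℝ} (hT : 0 ≤ T)
    {h : ℝ → ℝ} (hf : AbsolutelyContinuousOnInterval f 0 T)
    (hg : AbsolutelyContinuousOnInterval g 0 T)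
    (hf' : ∀ᵐ t ∂(volume.restrict (Icc 0 T)), HasDerivAt f (h t) t)
    (hg' : ∀ᵐ t ∂(volume.restrict (Icc 0 T)), HasDerivAt g (h t) t) (h0 : f 0 = g 0) :
    EqOn f g (Icc 0 T) := by
  obtain ⟨C, hC⟩ := (hf.fun_sub hg).const_of_ae_hasDerivAt_zero (by
    rw [uIcc_of_le hT]
    rw [ae_restrict_iff' measurableSet_Icc] at hf' hg'
    filter_upwards [hf', hg'] with t h1 h2 ht
    simpa using (h1 ht).fun_sub (h2 ht))
  rw [uIcc_of_le hT] at hC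
  intro t ht
  have h1 := hC t ht
  have h2 := hC 0 ⟨le_rfl, hT⟩
  linarith

theorem ae_hasDerivAt_integral_Icc {f : ℝ → ℝ} {T : ℝ} (hT : 0 ≤ T)
    (hf : IntervalIntegrable f volume 0 T) :
    ∀ᵐ t ∂(volume.restrict (Icc 0 T)), HasDerivAt (fun x => ∫ s in (0)..x, f s) (f t) t := by
  rw [ae_restrict_iff' measurableSet_Icc]
  filter_upwards [hf.ae_hasDerivAt_integral] with t ht htI
  rw [uIcc_of_le hT] at ht
  exact ht htI 0 ⟨le_rfl, hT⟩

theorem hasDerivAt_angle_cos {θ : ℝ → Real.Angle} {v t : ℝ}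
    (h : HasDerivAt (fun s => (θ s - θ t).toReal) v t) :
    HasDerivAt (fun s => (θ s).cos) (-(θ t).sin * v) t := by
  have e : (fun s => (θ s).cos) = fun s => (θ t).cos * Real.cos (θ s - θ t).toReal -
      (θ t).sin * Real.sin (θ s - θ t).toReal := by
    funext s
    rw [Real.Angle.cos_toReal, Real.Angle.sin_toReal, ← Real.Angle.cos_add, add_sub_cancel]
  rw [e]
  convert! (h.cos.const_mul _).sub (h.sin.const_mul _) using 1
  simp

theorem hasDerivAt_angle_sin {θ : ℝ → Real.Angle} {v t : ℝ}
    (h : HasDerivAt (fun s => (θ s - θ t).toReal) v t) :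
    HasDerivAt (fun s => (θ s).sin) ((θ t).cos * v) t := by
  have e : (fun s => (θ s).sin) = fun s => (θ t).sin * Real.cos (θ s - θ t).toReal +
      (θ t).cos * Real.sin (θ s - θ t).toReal := by
    funext s
    rw [Real.Angle.cos_toReal, Real.Angle.sin_toReal, ← Real.Angle.sin_add, add_sub_cancel]
  rw [e]
  convert! (h.cos.const_mul _).add (h.sin.const_mul _) using 1
  simp

/-- A differentiable real function, read in the circle, has the same derivative: near `t` its
values stay in the chart centred at its value at `t`. -/
theorem hasDerivAt_toReal_coe_sub {Θ : ℝ → ℝ} {v t : ℝ} (h : HasDerivAt Θ v t) :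
    HasDerivAt (fun s => ((Θ s : Real.Angle) - (Θ t : Real.Angle)).toReal) v t := by
  refine (h.sub_const (Θ t)).congr_of_eventuallyEq ?_
  have hc : Tendsto (fun s => Θ s - Θ t) (𝓝 t) (𝓝 0) := by
    simpa using h.continuousAt.tendsto.sub_const (Θ t)
  filter_upwards [hc (Ioo_mem_nhds (neg_lt_zero.2 Real.pi_pos) Real.pi_pos)] with s hs
  rw [← Real.Angle.coe_sub]
  exact Real.Angle.toReal_coe_eq_self_iff.2 ⟨hs.1, hs.2.le⟩

/-- A curve in the circle with almost everywhere velocity `u` lifts to the primitive of `u`. The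
difference `φ` of the two curves has cosine and sine with zero derivative. -/
theorem angle_eq_add_integral {θ : ℝ → Real.Angle} {u : ℝ → ℝ} {T : ℝ} (hT : 0 ≤ T)
    (hθ : AbsolutelyContinuousOnInterval θ 0 T) (hu : IntervalIntegrable u volume 0 T)
    (h : ∀ᵐ t ∂(volume.restrict (Icc 0 T)), HasDerivAt (fun s => (θ s - θ t).toReal) (u t) t)
    {t : ℝ} (ht : t ∈ Icc 0 T) :
    θ t = θ 0 + ((∫ s in (0)..t, u s : ℝ) : Real.Angle) := by
  set P : ℝ → ℝ := fun t => ∫ s in (0)..t, u s with hP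
  have hPac : AbsolutelyContinuousOnInterval P 0 T :=
    hu.absolutelyContinuousOnInterval_intervalIntegral (by simp)
  have hcθ := lipschitzWith_angle_cos.comp_absolutelyContinuousOnInterval hθ
  have hsθ := lipschitzWith_angle_sin.comp_absolutelyContinuousOnInterval hθ
  have hcP := lipschitzWith_real_cos.comp_absolutelyContinuousOnInterval hPac
  have hsP := lipschitzWith_real_sin.comp_absolutelyContinuousOnInterval hPac
  have hP' := ae_hasDerivAt_integral_Icc hT hu
  have hcos := eqOn_of_ae_hasDerivAt hT (h := fun _ => 0)
    (f := fun t => (θ t).cos * Real.cos (P t) + (θ t).sin * Real.sin (P t))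
    (g := fun _ => (θ 0).cos) ((hcθ.fun_mul hcP).fun_add (hsθ.fun_mul hsP))
    (absolutelyContinuousOnInterval_const _ _ _)
    (by
      filter_upwards [h, hP'] with t h1 h2
      convert! ((hasDerivAt_angle_cos h1).mul h2.cos).add
        ((hasDerivAt_angle_sin h1).mul h2.sin) using 1
      ring)
    (.of_forall fun _ => hasDerivAt_const _ _) (by simp [hP])
  have hsin := eqOn_of_ae_hasDerivAt hT (h := fun _ => 0)
    (f := fun t => (θ t).sin * Real.cos (P t) - (θ t).cos * Real.sin (P t))
    (g := fun _ => (θ 0).sin) ((hsθ.fun_mul hcP).fun_sub (hcθ.fun_mul hsP))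
    (absolutelyContinuousOnInterval_const _ _ _)
    (by
      filter_upwards [h, hP'] with t h1 h2
      convert! ((hasDerivAt_angle_sin h1).mul h2.cos).sub
        ((hasDerivAt_angle_cos h1).mul h2.sin) using 1
      ring)
    (.of_forall fun _ => hasDerivAt_const _ _) (by simp [hP])
  have hc := hcos ht
  have hs := hsin ht
  beta_reduce at hc hs
  have key : θ t - (P t : Real.Angle) = θ 0 := by
    have hc' : (θ t - (P t : Real.Angle)).cos = (θ 0).cos := by
      rw [sub_eq_add_neg, Real.Angle.cos_add, Real.Angle.cos_neg, Real.Angle.sin_neg,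
        Real.Angle.cos_coe, Real.Angle.sin_coe, ← hc]
      ring
    have hs' : (θ t - (P t : Real.Angle)).sin = (θ 0).sin := by
      rw [sub_eq_add_neg, Real.Angle.sin_add, Real.Angle.cos_neg, Real.Angle.sin_neg,
        Real.Angle.cos_coe, Real.Angle.sin_coe, ← hs]
      ring
    rw [← Real.Angle.coe_toReal (θ t - _), ← Real.Angle.coe_toReal (θ 0)]
    apply Real.Angle.cos_sin_inj <;> simpa using by assumption
  rw [← key]
  abel

/-! ### Trajectories as explicit integrals -/

/-- The real lift, starting at the representative of `q₀.θ` in `(-π, π]`, of the angular component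
of the trajectory issuing from `q₀` under the control `u`. -/
def angleLift (q₀ : State) (u : ℝ → ℝ) (t : ℝ) : ℝ := q₀.2.2.toReal + ∫ s in (0)..t, u s

/-- The trajectory issuing from `q₀` under the control `u`, obtained by two quadratures. -/
def trajectoryFrom (q₀ : State) (u : ℝ → ℝ) (t : ℝ) : State :=
  (q₀.1 + ∫ s in (0)..t, Real.cos (angleLift q₀ u s),
   q₀.2.1 + ∫ s in (0)..t, Real.sin (angleLift q₀ u s),
   (angleLift q₀ u t : Real.Angle))

variable {t₁ : ℝ} {q₀ q₁ : State} {u v : ℝ → ℝ} {q : ℝ → State}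

theorem trajectoryFrom_zero : trajectoryFrom q₀ u 0 = q₀ := by
  simp [trajectoryFrom, angleLift]

theorem IsAdmissibleControl.integrable (hu : IsAdmissibleControl t₁ u) :
    Integrable u (volume.restrict (Icc 0 t₁)) :=
  MemLp.integrable one_le_two hu

theorem IsAdmissibleControl.intervalIntegrable (hu : IsAdmissibleControl t₁ u) (ht₁ : 0 ≤ t₁) :
    IntervalIntegrable u volume 0 t₁ :=
  (intervalIntegrable_iff_integrableOn_Icc_of_le ht₁).2 hu.integrable

theorem absolutelyContinuous_angleLift (hu : IntervalIntegrable u volume 0 t₁) :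
    AbsolutelyContinuousOnInterval (angleLift q₀ u) 0 t₁ :=
  (absolutelyContinuousOnInterval_const q₀.2.2.toReal 0 t₁).fun_add
    (hu.absolutelyContinuousOnInterval_intervalIntegral (by simp))

theorem continuousOn_angleLift (ht₁ : 0 ≤ t₁) (hu : IntervalIntegrable u volume 0 t₁) :
    ContinuousOn (angleLift q₀ u) (Icc 0 t₁) := by
  simpa [uIcc_of_le ht₁] using (absolutelyContinuous_angleLift (q₀ := q₀) hu).continuousOn

theorem intervalIntegrable_comp_angleLift (ht₁ : 0 ≤ t₁) (hu : IntervalIntegrable u volume 0 t₁)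
    {f : ℝ → ℝ} (hf : Continuous f) :
    IntervalIntegrable (fun s => f (angleLift q₀ u s)) volume 0 t₁ := by
  refine ContinuousOn.intervalIntegrable ?_
  rw [uIcc_of_le ht₁]
  exact hf.comp_continuousOn (continuousOn_angleLift ht₁ hu)

theorem isTrajectory_trajectoryFrom (ht₁ : 0 ≤ t₁) (hu : IsAdmissibleControl t₁ u) :
    IsTrajectory t₁ u (trajectoryFrom q₀ u) := by
  have hui := hu.intervalIntegrable ht₁
  have hc := intervalIntegrable_comp_angleLift (q₀ := q₀) ht₁ hui Real.continuous_cos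
  have hs := intervalIntegrable_comp_angleLift (q₀ := q₀) ht₁ hui Real.continuous_sin
  refine ⟨hu, ?_, ?_⟩
  · refine absolutelyContinuousOnInterval_prodMk ?_ (absolutelyContinuousOnInterval_prodMk ?_ ?_)
    · exact (absolutelyContinuousOnInterval_const q₀.1 0 t₁).fun_add
        (hc.absolutelyContinuousOnInterval_intervalIntegral (by simp))
    · exact (absolutelyContinuousOnInterval_const q₀.2.1 0 t₁).fun_add
        (hs.absolutelyContinuousOnInterval_intervalIntegral (by simp))
    · exact lipschitzWith_coe.comp_absolutelyContinuousOnInterval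
        (absolutelyContinuous_angleLift hui)
  · filter_upwards [ae_hasDerivAt_integral_Icc ht₁ hui, ae_hasDerivAt_integral_Icc ht₁ hc,
      ae_hasDerivAt_integral_Icc ht₁ hs] with t h1 h2 h3
    refine ⟨?_, ?_, ?_⟩
    · simpa [trajectoryFrom, X₁, X₂] using h2.const_add q₀.1
    · simpa [trajectoryFrom, X₁, X₂] using h3.const_add q₀.2.1
    · simpa [trajectoryFrom, X₁, X₂] using
        hasDerivAt_toReal_coe_sub (Θ := angleLift q₀ u) (h1.const_add q₀.2.2.toReal)

/-- The trajectory of a control is determined by its initial point. -/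
theorem IsTrajectory.eqOn_trajectoryFrom (ht₁ : 0 ≤ t₁) (h : IsTrajectory t₁ u q) :
    EqOn q (trajectoryFrom (q 0) u) (Icc 0 t₁) := by
  obtain ⟨hu, hac, hv⟩ := h
  obtain ⟨-, hac', hv'⟩ := isTrajectory_trajectoryFrom (q₀ := q 0) ht₁ hu
  have hθ : ∀ t ∈ Icc 0 t₁, (q t).2.2 = (angleLift (q 0) u t : Real.Angle) := fun t ht => by
    rw [angleLift, Real.Angle.coe_add, Real.Angle.coe_toReal]
    refine angle_eq_add_integral (θ := fun t => (q t).2.2) ht₁ ?_ (hu.intervalIntegrable ht₁) ?_ ht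
    · exact absolutelyContinuousOnInterval_snd (absolutelyContinuousOnInterval_snd hac)
    · filter_upwards [hv] with t ht
      simpa [X₁, X₂] using ht.2.2
  have hx : EqOn (fun t => (q t).1) (fun t => (trajectoryFrom (q 0) u t).1) (Icc 0 t₁) := by
    refine eqOn_of_ae_hasDerivAt ht₁ (h := fun t => Real.cos (angleLift (q 0) u t))
      (absolutelyContinuousOnInterval_fst hac) (absolutelyContinuousOnInterval_fst hac') ?_ ?_ ?_
    · filter_upwards [hv, ae_restrict_mem measurableSet_Icc] with t ht htI
      simpa [X₁, X₂, hθ t htI] using ht.1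
    · filter_upwards [hv'] with t ht
      simpa [X₁, X₂, trajectoryFrom] using ht.1
    · rw [trajectoryFrom_zero]
  have hy : EqOn (fun t => (q t).2.1) (fun t => (trajectoryFrom (q 0) u t).2.1) (Icc 0 t₁) := by
    refine eqOn_of_ae_hasDerivAt ht₁ (h := fun t => Real.sin (angleLift (q 0) u t))
      (absolutelyContinuousOnInterval_fst (absolutelyContinuousOnInterval_snd hac))
      (absolutelyContinuousOnInterval_fst (absolutelyContinuousOnInterval_snd hac')) ?_ ?_ ?_
    · filter_upwards [hv, ae_restrict_mem measurableSet_Icc] with t ht htI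
      simpa [X₁, X₂, hθ t htI] using ht.2.1
    · filter_upwards [hv'] with t ht
      simpa [X₁, X₂, trajectoryFrom] using ht.2.1
    · rw [trajectoryFrom_zero]
  intro t ht
  exact Prod.ext (hx ht) (Prod.ext (hy ht) (hθ t ht))

theorem Connects.trajectoryFrom_eq (ht₁ : 0 ≤ t₁) (h : Connects t₁ q₀ q₁ u q) :
    trajectoryFrom q₀ u t₁ = q₁ := by
  obtain ⟨h, rfl, rfl⟩ := h
  exact (h.eqOn_trajectoryFrom ht₁ ⟨ht₁, le_rfl⟩).symm

theorem connects_trajectoryFrom (ht₁ : 0 ≤ t₁) (hu : IsAdmissibleControl t₁ u)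
    (h : trajectoryFrom q₀ u t₁ = q₁) : Connects t₁ q₀ q₁ u (trajectoryFrom q₀ u) :=
  ⟨isTrajectory_trajectoryFrom ht₁ hu, trajectoryFrom_zero, h⟩

theorem integral_congr_of_ae_Icc (h : u =ᵐ[volume.restrict (Icc 0 t₁)] v) {t : ℝ}
    (ht : t ∈ Icc 0 t₁) : ∫ s in (0)..t, u s = ∫ s in (0)..t, v s := by
  refine intervalIntegral.integral_congr_ae ?_
  rw [EventuallyEq, ae_restrict_iff' measurableSet_Icc] at h
  filter_upwards [h] with s hs hst
  rw [uIoc_of_le ht.1] at hst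
  exact hs ⟨hst.1.le, hst.2.trans ht.2⟩

theorem angleLift_congr (h : u =ᵐ[volume.restrict (Icc 0 t₁)] v) {t : ℝ} (ht : t ∈ Icc 0 t₁) :
    angleLift q₀ u t = angleLift q₀ v t := by
  rw [angleLift, angleLift, integral_congr_of_ae_Icc h ht]

theorem trajectoryFrom_congr (h : u =ᵐ[volume.restrict (Icc 0 t₁)] v) {t : ℝ}
    (ht : t ∈ Icc 0 t₁) : trajectoryFrom q₀ u t = trajectoryFrom q₀ v t := by
  have hf : ∀ f : ℝ → ℝ, ∫ s in (0)..t, f (angleLift q₀ u s) =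
      ∫ s in (0)..t, f (angleLift q₀ v s) :=
    fun f => intervalIntegral.integral_congr fun s hs => by
      rw [uIcc_of_le ht.1] at hs
      exact congrArg f (angleLift_congr h ⟨hs.1, hs.2.trans ht.2⟩)
  rw [trajectoryFrom, trajectoryFrom, angleLift_congr h ht, hf, hf]

/-! ### Controls as vectors of the Hilbert space `L²[0, t₁]` -/

/-- The Hilbert space `L²[0, t₁]`. -/
abbrev ControlSpace (t₁ : ℝ) : Type := Lp ℝ 2 (volume.restrict (Icc 0 t₁))

/-- The indicator function of `(0, t]`, whose inner product with a control is the primitive of the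
control at `t`. -/
def primitiveVec (t₁ t : ℝ) : ControlSpace t₁ :=
  indicatorConstLp 2 (measurableSet_Ioc (a := 0) (b := t)) (measure_ne_top _ _) 1

theorem inner_primitiveVec (w : ControlSpace t₁) {t : ℝ} (ht : t ∈ Icc 0 t₁) :
    inner ℝ (primitiveVec t₁ t) w = ∫ s in (0)..t, w s := by
  rw [primitiveVec, L2.inner_indicatorConstLp_one, intervalIntegral.integral_of_le ht.1,
    Measure.restrict_restrict measurableSet_Ioc, inter_eq_left.2]
  exact fun s hs => ⟨hs.1.le, hs.2.trans ht.2⟩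

theorem norm_primitiveVec_le (t : ℝ) : ‖primitiveVec t₁ t‖ ≤ √(max t₁ 0) := by
  rw [primitiveVec, norm_indicatorConstLp (by simp) (by simp), norm_one, one_mul,
    ENNReal.toReal_ofNat, Real.sqrt_eq_rpow]
  refine Real.rpow_le_rpow measureReal_nonneg ?_ (by norm_num)
  refine (measureReal_mono (subset_univ _)).trans ?_
  simp [Measure.real, ENNReal.toReal_ofReal']

theorem isAdmissibleControl_coe (w : ControlSpace t₁) : IsAdmissibleControl t₁ w := Lp.memLp w

theorem angleLift_coe (w : ControlSpace t₁) {t : ℝ} (ht : t ∈ Icc 0 t₁) :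
    angleLift q₀ w t = q₀.2.2.toReal + inner ℝ (primitiveVec t₁ t) w := by
  rw [angleLift, inner_primitiveVec w ht]

theorem energy_congr (ht₁ : 0 ≤ t₁) (h : u =ᵐ[volume.restrict (Icc 0 t₁)] v) :
    energy t₁ u = energy t₁ v := by
  rw [energy, energy, integral_congr_of_ae_Icc (u := fun t => u t ^ 2) (v := fun t => v t ^ 2)
    (h.mono fun t ht => by beta_reduce; rw [ht]) ⟨ht₁, le_rfl⟩]

theorem energy_coe (ht₁ : 0 ≤ t₁) (w : ControlSpace t₁) : energy t₁ w = 1 / 2 * ‖w‖ ^ 2 := by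
  rw [energy, ← real_inner_self_eq_norm_sq, L2.inner_def, intervalIntegral.integral_of_le ht₁,
    ← integral_Icc_eq_integral_Ioc]
  simp [pow_two]

/-! ### Strict differentiability of the endpoint functionals -/

/-- For `f` with `1`-Lipschitz derivative `f'`, the first-order Taylor error of a difference. -/
theorem abs_sub_sub_deriv_mul_le {f f' : ℝ → ℝ} (hf : ∀ x, HasDerivAt f (f' x) x)
    (hf' : LipschitzWith 1 f') (a b c : ℝ) :
    |f a - f b - f' c * (a - b)| ≤ max |a - c| |b - c| * |a - b| := by
  have h := Convex.norm_image_sub_le_of_norm_hasDerivWithin_le (𝕜 := ℝ)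
    (f := fun x => f x - f' c * x) (f' := fun x => f' x - f' c * 1) (s := uIcc b a)
    (C := max |a - c| |b - c|) (x := b) (y := a)
    (fun x _ => ((hf x).sub ((hasDerivAt_id x).const_mul (f' c))).hasDerivWithinAt)
    (fun x hx => by
      have h1 := hf'.dist_le_mul x c
      rw [Real.dist_eq, Real.dist_eq, NNReal.coe_one, one_mul] at h1
      rw [mul_one, Real.norm_eq_abs]
      refine h1.trans ?_
      rw [mem_uIcc] at hx
      rcases hx with hx | hx
      · rw [max_comm]
        exact abs_le_max_abs_abs (by linarith) (by linarith)
      · exact abs_le_max_abs_abs (by linarith) (by linarith))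
    (convex_uIcc b a) left_mem_uIcc right_mem_uIcc
  rw [Real.norm_eq_abs, Real.norm_eq_abs] at h
  convert h using 2
  ring

/-- The function `s ↦ ∫ₛ^{t₁} f(θ(t)) dt`, where `θ` is the angle driven by `u`. -/
def tailIntegral (t₁ : ℝ) (q₀ : State) (f : ℝ → ℝ) (u : ℝ → ℝ) (s : ℝ) : ℝ :=
  ∫ t in s..t₁, f (angleLift q₀ u t)

theorem tailIntegral_eq (ht₁ : 0 ≤ t₁) (hu : IntervalIntegrable u volume 0 t₁) {f : ℝ → ℝ}
    (hf : Continuous f) {s : ℝ} (hs : s ∈ Icc 0 t₁) :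
    tailIntegral t₁ q₀ f u s = (∫ t in (0)..t₁, f (angleLift q₀ u t)) -
      ∫ t in (0)..s, f (angleLift q₀ u t) := by
  have hi := intervalIntegrable_comp_angleLift (q₀ := q₀) ht₁ hu hf
  rw [tailIntegral, intervalIntegral.integral_interval_sub_left hi]
  exact hi.mono_set (uIcc_subset_uIcc left_mem_uIcc (by rwa [uIcc_of_le ht₁]))

theorem continuousOn_tailIntegral (ht₁ : 0 ≤ t₁) (hu : IntervalIntegrable u volume 0 t₁)
    {f : ℝ → ℝ} (hf : Continuous f) : ContinuousOn (tailIntegral t₁ q₀ f u) (Icc 0 t₁) := by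
  have hi := intervalIntegrable_comp_angleLift (q₀ := q₀) ht₁ hu hf
  have hc := (hi.absolutelyContinuousOnInterval_intervalIntegral left_mem_uIcc).continuousOn
  rw [uIcc_of_le ht₁] at hc
  exact (continuousOn_const.sub hc).congr fun s hs => tailIntegral_eq ht₁ hu hf hs

theorem memLp_of_continuousOn {g : ℝ → ℝ} (hg : ContinuousOn g (Icc 0 t₁)) (p : ENNReal) :
    MemLp g p (volume.restrict (Icc 0 t₁)) := by
  obtain ⟨C, hC⟩ := isCompact_Icc.exists_bound_of_continuousOn hg
  refine MemLp.of_bound (hg.aestronglyMeasurable measurableSet_Icc) C ?_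
  filter_upwards [ae_restrict_mem measurableSet_Icc] with t ht using hC t ht

theorem memLp_tailIntegral (ht₁ : 0 ≤ t₁) (w : ControlSpace t₁) {f : ℝ → ℝ} (hf : Continuous f) :
    MemLp (tailIntegral t₁ q₀ f w) 2 (volume.restrict (Icc 0 t₁)) :=
  memLp_of_continuousOn
    (continuousOn_tailIntegral ht₁ ((isAdmissibleControl_coe w).intervalIntegrable ht₁) hf) 2

/-- Integration by parts: the tail integral is the Riesz representative of the functional
`w ↦ ∫₀^{t₁} f(θ(t)) (∫₀ᵗ w) dt`. -/
theorem inner_tailIntegral (ht₁ : 0 ≤ t₁) (z w : ControlSpace t₁) {f : ℝ → ℝ}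
    (hf : Continuous f) :
    inner ℝ ((memLp_tailIntegral (q₀ := q₀) ht₁ z hf).toLp _) w =
      ∫ t in (0)..t₁, f (angleLift q₀ z t) * inner ℝ (primitiveVec t₁ t) w := by
  have hz := (isAdmissibleControl_coe z).intervalIntegrable ht₁
  have hw := (isAdmissibleControl_coe w).intervalIntegrable ht₁
  have hi := intervalIntegrable_comp_angleLift (q₀ := q₀) ht₁ hz hf
  have hA := hi.absolutelyContinuousOnInterval_intervalIntegral left_mem_uIcc
  have hP := hw.absolutelyContinuousOnInterval_intervalIntegral left_mem_uIcc
  have hparts := hA.integral_mul_deriv_eq_deriv_mul hP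
  have toAe : ∀ {p : ℝ → Prop}, (∀ᵐ t ∂(volume.restrict (Icc 0 t₁)), p t) →
      ∀ᵐ t, t ∈ uIoc 0 t₁ → p t := fun h => by
    rw [ae_restrict_iff' measurableSet_Icc] at h
    filter_upwards [h] with t ht h2
    rw [uIoc_of_le ht₁] at h2
    exact ht ⟨h2.1.le, h2.2⟩
  have e1 : ∫ t in (0)..t₁, (∫ s in (0)..t, f (angleLift q₀ z s)) *
      deriv (fun x => ∫ s in (0)..x, w s) t =
      ∫ t in (0)..t₁, (∫ s in (0)..t, f (angleLift q₀ z s)) * w t := by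
    refine intervalIntegral.integral_congr_ae (toAe ?_)
    filter_upwards [ae_hasDerivAt_integral_Icc ht₁ hw] with t ht
    rw [ht.deriv]
  have e2 : ∫ t in (0)..t₁, deriv (fun x => ∫ s in (0)..x, f (angleLift q₀ z s)) t *
      (∫ s in (0)..t, w s) =
      ∫ t in (0)..t₁, f (angleLift q₀ z t) * inner ℝ (primitiveVec t₁ t) w := by
    refine intervalIntegral.integral_congr_ae (toAe ?_)
    filter_upwards [ae_hasDerivAt_integral_Icc ht₁ hi, ae_restrict_mem measurableSet_Icc]
      with t ht htI
    rw [ht.deriv, inner_primitiveVec w htI]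
  rw [e1, e2] at hparts
  have e3 : inner ℝ ((memLp_tailIntegral (q₀ := q₀) ht₁ z hf).toLp _) w =
      ∫ t in (0)..t₁, ((∫ t in (0)..t₁, f (angleLift q₀ z t)) * w t -
        (∫ s in (0)..t, f (angleLift q₀ z s)) * w t) := by
    rw [L2.inner_def, intervalIntegral.integral_of_le ht₁, ← integral_Icc_eq_integral_Ioc]
    refine integral_congr_ae ?_
    filter_upwards [(memLp_tailIntegral (q₀ := q₀) ht₁ z hf).coeFn_toLp,
      ae_restrict_mem measurableSet_Icc] with t ht htI
    rw [ht, tailIntegral_eq ht₁ hz hf htI]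
    simp only [RCLike.inner_apply, conj_trivial]
    ring
  rw [e3, intervalIntegral.integral_sub (hw.const_mul _) (hw.continuousOn_mul hA.continuousOn),
    hparts, intervalIntegral.integral_const_mul]
  simp

theorem hasStrictFDerivAt_integral_comp_angleLift (ht₁ : 0 ≤ t₁) {f f' : ℝ → ℝ}
    (hf : ∀ x, HasDerivAt f (f' x) x) (hf' : LipschitzWith 1 f') (z : ControlSpace t₁) :
    HasStrictFDerivAt (fun w : ControlSpace t₁ => ∫ t in (0)..t₁, f (angleLift q₀ w t))
      (innerSL ℝ ((memLp_tailIntegral (q₀ := q₀) ht₁ z hf'.continuous).toLp _)) z := by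
  have hfc : Continuous f := continuous_iff_continuousAt.2 fun x => (hf x).continuousAt
  refine .of_isLittleO (Asymptotics.isLittleO_iff.2 fun ε hε => ?_)
  -- The Taylor error at each time is at most `(C δ) (C ‖w₁ - w₂‖)` when `w₁, w₂` are `δ`-close
  -- to `z`, where `C` bounds the evaluation of the primitive.
  set C : ℝ := √(max t₁ 0) with hC
  have hC0 : 0 ≤ C := Real.sqrt_nonneg _
  set δ : ℝ := ε / (C * C * t₁ + 1) with hδ
  have hden : 0 < C * C * t₁ + 1 := by positivity
  have hδ0 : 0 < δ := by positivity
  have hnear : ∀ᶠ p : ControlSpace t₁ × ControlSpace t₁ in 𝓝 (z, z),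
      ‖p.1 - z‖ < δ ∧ ‖p.2 - z‖ < δ := by
    have h1 : ∀ᶠ w : ControlSpace t₁ in 𝓝 z, ‖w - z‖ < δ := by
      filter_upwards [Metric.ball_mem_nhds z hδ0] with w hw
      rwa [← dist_eq_norm]
    rw [nhds_prod_eq]
    exact h1.prod_mk h1
  filter_upwards [hnear] with p ⟨hp1, hp2⟩
  have hlift : ∀ (a b : ControlSpace t₁), ∀ t ∈ Icc 0 t₁,
      angleLift q₀ a t - angleLift q₀ b t = inner ℝ (primitiveVec t₁ t) (a - b) :=
    fun a b t ht => by
      rw [angleLift_coe a ht, angleLift_coe b ht, inner_sub_right]; ring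
  have hbound : ∀ (a b : ControlSpace t₁), ∀ t ∈ Icc 0 t₁,
      |angleLift q₀ a t - angleLift q₀ b t| ≤ C * ‖a - b‖ := fun a b t ht => by
    rw [hlift a b t ht]
    exact (abs_real_inner_le_norm _ _).trans
      (mul_le_mul_of_nonneg_right (norm_primitiveVec_le t) (norm_nonneg _))
  have hii : ∀ w : ControlSpace t₁, IntervalIntegrable (fun s => f (angleLift q₀ w s))
      volume 0 t₁ := fun w => intervalIntegrable_comp_angleLift ht₁
    ((isAdmissibleControl_coe w).intervalIntegrable ht₁) hfc
  have hi' : IntervalIntegrable (fun t => f' (angleLift q₀ z t) *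
      inner ℝ (primitiveVec t₁ t) (p.1 - p.2)) volume 0 t₁ := by
    have hcont : ContinuousOn (fun t => f' (angleLift q₀ z t) *
        (angleLift q₀ p.1 t - angleLift q₀ p.2 t)) (Icc 0 t₁) := by
      have hl : ∀ w : ControlSpace t₁, ContinuousOn (angleLift q₀ w) (Icc 0 t₁) := fun w =>
        continuousOn_angleLift ht₁ ((isAdmissibleControl_coe w).intervalIntegrable ht₁)
      exact (hf'.continuous.comp_continuousOn (hl z)).mul ((hl _).sub (hl _))
    refine ContinuousOn.intervalIntegrable ?_
    rw [uIcc_of_le ht₁]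
    exact hcont.congr fun t ht => by beta_reduce; rw [hlift _ _ t ht]
  rw [innerSL_apply_apply, inner_tailIntegral ht₁ z _ hf'.continuous,
    ← intervalIntegral.integral_sub (hii _) (hii _),
    ← intervalIntegral.integral_sub ((hii _).sub (hii _)) hi']
  refine (intervalIntegral.norm_integral_le_of_norm_le_const
    (C := C * δ * (C * ‖p.1 - p.2‖)) fun t ht => ?_).trans ?_
  · rw [uIoc_of_le ht₁] at ht
    have htI : t ∈ Icc 0 t₁ := ⟨ht.1.le, ht.2⟩
    rw [Real.norm_eq_abs, ← hlift _ _ t htI]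
    refine (abs_sub_sub_deriv_mul_le hf hf' _ _ _).trans ?_
    refine mul_le_mul (max_le ?_ ?_) (hbound _ _ t htI) (abs_nonneg _) (by positivity)
    · exact (hbound _ _ t htI).trans (by gcongr)
    · exact (hbound _ _ t htI).trans (by gcongr)
  · rw [sub_zero, abs_of_nonneg ht₁]
    calc C * δ * (C * ‖p.1 - p.2‖) * t₁ = (C * C * t₁ * δ) * ‖p.1 - p.2‖ := by ring
      _ ≤ ε * ‖p.1 - p.2‖ := by
        gcongr
        rw [hδ, ← mul_div_assoc, div_le_iff₀ hden]
        nlinarith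

/-! ### The Lagrange multiplier rule and the maximum principle -/

theorem coeFn_primitiveVec_self :
    ∀ᵐ t ∂(volume.restrict (Icc 0 t₁)), primitiveVec t₁ t₁ t = 1 := by
  have hpos : ∀ᵐ t ∂(volume.restrict (Icc 0 t₁)), t ∈ Ioc 0 t₁ := by
    rw [← restrict_Ioc_eq_restrict_Icc]
    exact ae_restrict_mem measurableSet_Ioc
  filter_upwards [indicatorConstLp_coeFn (p := 2) (c := (1 : ℝ))
    (hs := measurableSet_Ioc (a := (0 : ℝ)) (b := t₁))
    (hμs := measure_ne_top (volume.restrict (Icc 0 t₁)) _), hpos] with t ht htI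
  rw [primitiveVec, ht, indicator_of_mem htI]

/-- The Lagrange multiplier rule for the energy under the endpoint constraints. The covector
`(a, b)` is dual to the plane coordinates, `c` to the final angle, `ν` to the energy. -/
theorem exists_multipliers (ht₁ : 0 ≤ t₁) (h : IsOptimalSolution t₁ q₀ q₁ u q) :
    ∃ a b c ν : ℝ, ν ≤ 0 ∧ (ν = 0 → a = 0 → b = 0 → c ≠ 0) ∧
      ∀ᵐ t ∂(volume.restrict (Icc 0 t₁)),
        c + a * tailIntegral t₁ q₀ (fun x => -Real.sin x) u t +
          b * tailIntegral t₁ q₀ Real.cos u t + ν * u t = 0 := by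
  obtain ⟨hcon, hmin⟩ := h
  have hu : IsAdmissibleControl t₁ u := hcon.1.1
  set z : ControlSpace t₁ := hu.toLp u with hz
  have hzu : z =ᵐ[volume.restrict (Icc 0 t₁)] u := hu.coeFn_toLp
  have hend : t₁ ∈ Icc 0 t₁ := ⟨ht₁, le_rfl⟩
  have hzq : trajectoryFrom q₀ z t₁ = q₁ := by
    rw [trajectoryFrom_congr hzu hend, hcon.trajectoryFrom_eq ht₁]
  have hsin' : LipschitzWith 1 (fun x => -Real.sin x) := lipschitzWith_real_sin.neg
  set G₁ : ControlSpace t₁ :=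
    (memLp_tailIntegral (q₀ := q₀) ht₁ z hsin'.continuous).toLp _ with hG₁
  set G₂ : ControlSpace t₁ :=
    (memLp_tailIntegral (q₀ := q₀) ht₁ z Real.continuous_cos).toLp _ with hG₂
  set F : Fin 3 → ControlSpace t₁ → ℝ :=
    ![fun w => ∫ t in (0)..t₁, Real.cos (angleLift q₀ w t),
      fun w => ∫ t in (0)..t₁, Real.sin (angleLift q₀ w t),
      fun w => innerSL ℝ (primitiveVec t₁ t₁) w] with hF
  set F' : Fin 3 → StrongDual ℝ (ControlSpace t₁) :=
    ![innerSL ℝ G₁,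
      innerSL ℝ G₂,
      innerSL ℝ (primitiveVec t₁ t₁)] with hF'
  have hderiv : ∀ i, HasStrictFDerivAt (F i) (F' i) z := by
    intro i
    fin_cases i
    · exact hasStrictFDerivAt_integral_comp_angleLift ht₁ Real.hasDerivAt_cos hsin' z
    · exact hasStrictFDerivAt_integral_comp_angleLift ht₁ Real.hasDerivAt_sin
        lipschitzWith_real_cos z
    · exact (innerSL ℝ (primitiveVec t₁ t₁)).hasStrictFDerivAt
  have hextr : IsLocalExtrOn (fun w : ControlSpace t₁ => ‖w‖ ^ 2) {w | ∀ i, F i w = F i z} z := by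
    refine IsExtrOn.localize (Or.inl fun w hw => ?_)
    have h0 : ∫ t in (0)..t₁, Real.cos (angleLift q₀ w t) =
      ∫ t in (0)..t₁, Real.cos (angleLift q₀ z t) := hw 0
    have h1 : ∫ t in (0)..t₁, Real.sin (angleLift q₀ w t) =
      ∫ t in (0)..t₁, Real.sin (angleLift q₀ z t) := hw 1
    have h2 : inner ℝ (primitiveVec t₁ t₁) w = inner ℝ (primitiveVec t₁ t₁) z := hw 2
    have hwq : trajectoryFrom q₀ w t₁ = q₁ := by
      rw [← hzq, trajectoryFrom, trajectoryFrom, angleLift_coe w hend, angleLift_coe z hend,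
        h0, h1, h2]
    have hle := hmin w _ (connects_trajectoryFrom ht₁ (isAdmissibleControl_coe w) hwq)
    rw [← energy_congr ht₁ hzu, energy_coe ht₁, energy_coe ht₁] at hle
    change ‖z‖ ^ 2 ≤ ‖w‖ ^ 2
    linarith
  obtain ⟨Λ, Λ₀, hne, hsum⟩ :=
    hextr.exists_multipliers_of_hasStrictFDerivAt hderiv (hasStrictFDerivAt_norm_sq z)
  -- Evaluate the vanishing functional through its Riesz representative.
  have hvec : Λ 0 • G₁ +
      Λ 1 • G₂ +
      Λ 2 • primitiveVec t₁ t₁ + (2 * Λ₀) • z = 0 := by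
    refine ext_inner_right ℝ fun w => ?_
    have hw := DFunLike.congr_fun hsum w
    simp [Fin.sum_univ_three, hF'] at hw
    simp only [inner_add_left, inner_smul_left, inner_zero_left, conj_trivial]
    linarith
  have hae : ∀ᵐ t ∂(volume.restrict (Icc 0 t₁)),
      Λ 2 + Λ 0 * tailIntegral t₁ q₀ (fun x => -Real.sin x) u t +
        Λ 1 * tailIntegral t₁ q₀ Real.cos u t + (2 * Λ₀) * u t = 0 := by
    have h0 := Lp.ext_iff.1 hvec
    have htail : ∀ f : ℝ → ℝ, ∀ t ∈ Icc 0 t₁,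
        tailIntegral t₁ q₀ f z t = tailIntegral t₁ q₀ f u t := fun f t ht =>
      intervalIntegral.integral_congr fun s hs => by
        rw [uIcc_of_le ht.2] at hs
        exact congrArg f (angleLift_congr hzu ⟨ht.1.trans hs.1, hs.2⟩)
    filter_upwards [h0, hzu, Lp.coeFn_zero ℝ 2 (volume.restrict (Icc 0 t₁)),
      Lp.coeFn_add (Λ 0 • G₁ +
        Λ 1 • G₂ +
        Λ 2 • primitiveVec t₁ t₁) ((2 * Λ₀) • z),
      Lp.coeFn_add (Λ 0 • G₁ +
        Λ 1 • G₂)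
        (Λ 2 • primitiveVec t₁ t₁),
      Lp.coeFn_add (Λ 0 • G₁)
        (Λ 1 • G₂),
      Lp.coeFn_smul (Λ 0) G₁,
      Lp.coeFn_smul (Λ 1) G₂,
      Lp.coeFn_smul (Λ 2) (primitiveVec t₁ t₁), Lp.coeFn_smul (2 * Λ₀) z,
      (memLp_tailIntegral (q₀ := q₀) ht₁ z hsin'.continuous).coeFn_toLp,
      (memLp_tailIntegral (q₀ := q₀) ht₁ z Real.continuous_cos).coeFn_toLp,
      coeFn_primitiveVec_self, ae_restrict_mem measurableSet_Icc]
      with t e0 e1 e2 e3 e4 e5 e6 e7 e8 e9 e10 e11 e12 htI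
    rw [e2, e3, Pi.add_apply, e4, Pi.add_apply, e5, Pi.add_apply, e6, e7, e8, e9] at e0
    simp only [Pi.smul_apply, smul_eq_mul, Pi.zero_apply] at e0
    rw [e10, e11, e12, e1, htail _ t htI, htail _ t htI] at e0
    linarith
  have hnz : 2 * Λ₀ = 0 → Λ 0 = 0 → Λ 1 = 0 → Λ 2 ≠ 0 := fun e e0 e1 e2 => hne (by
    rw [Prod.mk_eq_zero]
    refine ⟨funext fun i => ?_, by linarith⟩
    fin_cases i
    · exact e0
    · exact e1
    · exact e2)
  -- Multipliers are determined up to a common factor, so the sign of `ν` can be chosen.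
  rcases le_total (2 * Λ₀) 0 with hs | hs
  · exact ⟨Λ 0, Λ 1, Λ 2, 2 * Λ₀, hs, hnz, hae⟩
  · refine ⟨-Λ 0, -Λ 1, -Λ 2, -(2 * Λ₀), by linarith, fun e e0 e1 => ?_, ?_⟩
    · exact neg_ne_zero.2 (hnz (neg_eq_zero.1 e) (neg_eq_zero.1 e0) (neg_eq_zero.1 e1))
    · filter_upwards [hae] with t ht
      linarith

theorem hamHorizontal_hamiltonian (ν w : ℝ) (l : Cotangent) :
    hamHorizontal (hamiltonian ν w) l = X₁ l.1 + w • X₂ l.1 := by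
  have key : ∀ A B : ℝ, deriv (fun s : ℝ => A * s + B) 0 = A := fun A B => by
    simp
  refine Prod.ext ?_ (Prod.ext ?_ ?_)
  · refine Eq.trans (congrArg (deriv · 0) (funext fun s => ?_))
      (key (X₁ l.1 + w • X₂ l.1).1 (hamiltonian ν w l))
    simp only [hamiltonian, pairing, X₁, X₂, Prod.fst_add, Prod.snd_add, Prod.smul_fst,
      Prod.smul_snd, smul_eq_mul]
    ring
  · refine Eq.trans (congrArg (deriv · 0) (funext fun s => ?_))
      (key (X₁ l.1 + w • X₂ l.1).2.1 (hamiltonian ν w l))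
    simp only [hamiltonian, pairing, X₁, X₂, Prod.fst_add, Prod.snd_add, Prod.smul_fst,
      Prod.smul_snd, smul_eq_mul]
    ring
  · refine Eq.trans (congrArg (deriv · 0) (funext fun s => ?_))
      (key (X₁ l.1 + w • X₂ l.1).2.2 (hamiltonian ν w l))
    simp only [hamiltonian, pairing, X₁, X₂, Prod.fst_add, Prod.snd_add, Prod.smul_fst,
      Prod.smul_snd, smul_eq_mul]
    ring

theorem hamVertical_hamiltonian (ν w : ℝ) (l : Cotangent) :
    hamVertical (hamiltonian ν w) l =
      (0, 0, l.2.1 * l.1.2.2.sin - l.2.2.1 * l.1.2.2.cos) := by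
  have hang : HasDerivAt (fun s : ℝ => (l.1.2.2 + (s : Real.Angle) - (l.1.2.2 + ((0 : ℝ) :
      Real.Angle))).toReal) 1 0 := by
    have := hasDerivAt_toReal_coe_sub (hasDerivAt_id (0 : ℝ))
    simpa using this
  refine Prod.ext ?_ (Prod.ext ?_ ?_)
  · simp [hamVertical, hamiltonian, pairing, X₁, X₂]
  · simp [hamVertical, hamiltonian, pairing, X₁, X₂]
  · have h : HasDerivAt (fun s : ℝ => hamiltonian ν w (l.1 + (0, 0, (s : Real.Angle)), l.2))
        (-(l.2.1 * l.1.2.2.sin - l.2.2.1 * l.1.2.2.cos)) 0 := by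
      have hd := (((hasDerivAt_angle_cos hang).const_mul l.2.1).add
        ((hasDerivAt_angle_sin hang).const_mul l.2.2.1)).add_const
          (l.2.2.2 * w + ν / 2 * w ^ 2)
      convert! hd using 1
      · funext s
        simp [hamiltonian, pairing, X₁, X₂]
        ring
      · simp
        ring
    simp only [hamVertical, h.deriv, neg_neg]

theorem hamiltonian_eq (ν w : ℝ) (l : Cotangent) :
    hamiltonian ν w l = l.2.1 * l.1.2.2.cos + l.2.2.1 * l.1.2.2.sin + w * l.2.2.2 +
      ν / 2 * w ^ 2 := by
  simp [hamiltonian, pairing, X₁, X₂]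
  ring

/-- The maximum principle: the multipliers give the constant components `a, b` of the covector,
and the third component is `c + ∫ₜ^{t₁} (b cos θ - a sin θ)`. -/
theorem IsOptimalSolution.satisfiesPMP (ht₁ : 0 ≤ t₁) (h : IsOptimalSolution t₁ q₀ q₁ u q) :
    SatisfiesPMP t₁ u q := by
  obtain ⟨a, b, c, ν, hν, hne, hae⟩ := exists_multipliers ht₁ h
  obtain ⟨⟨htraj, hq0, -⟩, -⟩ := h
  have hu : IsAdmissibleControl t₁ u := htraj.1
  have hui := hu.intervalIntegrable ht₁
  have hqE := htraj.eqOn_trajectoryFrom ht₁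
  rw [hq0] at hqE
  set g : ℝ → ℝ := fun t => b * Real.cos (angleLift q₀ u t) - a * Real.sin (angleLift q₀ u t)
    with hg
  have hgi : IntervalIntegrable g volume 0 t₁ :=
    intervalIntegrable_comp_angleLift ht₁ hui
      (f := fun x => b * Real.cos x - a * Real.sin x) (by fun_prop)
  set p : ℝ → ℝ := fun t => (c + ∫ s in (0)..t₁, g s) - ∫ s in (0)..t, g s with hp
  have hpu : ∀ᵐ t ∂(volume.restrict (Icc 0 t₁)), p t + ν * u t = 0 := by
    have hci := intervalIntegrable_comp_angleLift (q₀ := q₀) ht₁ hui Real.continuous_cos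
    have hsi := intervalIntegrable_comp_angleLift (q₀ := q₀) ht₁ hui Real.continuous_sin
    have hint : ∀ t ∈ Icc 0 t₁, ∫ s in (0)..t, g s =
        b * (∫ s in (0)..t, Real.cos (angleLift q₀ u s)) +
          a * ∫ s in (0)..t, -Real.sin (angleLift q₀ u s) := fun t ht => by
      have hsub : uIcc 0 t ⊆ uIcc 0 t₁ :=
        uIcc_subset_uIcc left_mem_uIcc (by rwa [uIcc_of_le ht₁])
      rw [hg, intervalIntegral.integral_sub ((hci.mono_set hsub).const_mul b)
        ((hsi.mono_set hsub).const_mul a), intervalIntegral.integral_const_mul,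
        intervalIntegral.integral_const_mul, intervalIntegral.integral_neg]
      ring
    filter_upwards [hae, ae_restrict_mem measurableSet_Icc] with t ht htI
    rw [tailIntegral_eq ht₁ hui Real.continuous_cos htI,
      tailIntegral_eq (f := fun x => -Real.sin x) ht₁ hui Real.continuous_sin.neg htI] at ht
    rw [hp]
    beta_reduce
    rw [hint t htI, hint t₁ ⟨ht₁, le_rfl⟩]
    linarith
  refine ⟨ν, htraj, hν, fun t => (q t, (a, b, p t)), ?_, fun _ _ => rfl, ?_⟩
  · refine absolutelyContinuousOnInterval_prodMk htraj.2.1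
      (absolutelyContinuousOnInterval_prodMk (absolutelyContinuousOnInterval_const _ _ _)
        (absolutelyContinuousOnInterval_prodMk (absolutelyContinuousOnInterval_const _ _ _) ?_))
    exact (absolutelyContinuousOnInterval_const _ _ _).fun_sub
      (hgi.absolutelyContinuousOnInterval_intervalIntegral left_mem_uIcc)
  · filter_upwards [htraj.2.2, ae_hasDerivAt_integral_Icc ht₁ hgi, hpu,
      ae_restrict_mem measurableSet_Icc] with t hv hgt hput htI
    have hθ : (q t).2.2 = (angleLift q₀ u t : Real.Angle) := by rw [hqE htI]; rfl
    refine ⟨⟨?_, ?_⟩, fun w => ?_, fun h0 => ?_⟩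
    · rw [hamHorizontal_hamiltonian]
      exact hv
    · rw [hamVertical_hamiltonian]
      refine (hasDerivAt_const t a).prodMk ((hasDerivAt_const t b).prodMk ?_)
      convert! hgt.const_sub (c + ∫ s in (0)..t₁, g s) using 1
      simp [hg, hθ]
    · -- With `p = -ν u`, the difference of the two sides is `-(ν / 2) (w - u)² ≥ 0`.
      rw [hamiltonian_eq, hamiltonian_eq]
      have : p t = -ν * u t := by linarith
      simp only [this]
      nlinarith [mul_nonneg (neg_nonneg.2 hν) (sq_nonneg (w - u t))]
    · simp only [Prod.mk_eq_zero] at h0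
      obtain ⟨h1, h2, h3, h4⟩ := h0
      refine hne h1 h2 h3 ?_
      simpa [hp, hg, h2, h3] using h4

/-! ### Abnormal extremals and regularity of optimal controls -/

/-- Along an abnormal extremal the third component of the covector vanishes identically, so
`p₁ sin θ = p₂ cos θ` with a constant vector `(p₁, p₂) ≠ 0`; differentiating, `θ` is constant. -/
theorem IsAbnormalExtremalControl.ae_eq_zero (ht₁ : 0 < t₁)
    (h : IsAbnormalExtremalControl t₁ u) : ∀ᵐ t ∂(volume.restrict (Icc 0 t₁)), u t = 0 := by
  obtain ⟨q, htraj, -, l, hlac, hlq, hae⟩ := h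
  have hpac := absolutelyContinuousOnInterval_snd hlac
  have hp1ac := absolutelyContinuousOnInterval_fst hpac
  have hp2ac := absolutelyContinuousOnInterval_fst (absolutelyContinuousOnInterval_snd hpac)
  have hp3ac := absolutelyContinuousOnInterval_snd (absolutelyContinuousOnInterval_snd hpac)
  have hθac := absolutelyContinuousOnInterval_snd (absolutelyContinuousOnInterval_snd
    (absolutelyContinuousOnInterval_fst hlac))
  have hp' : ∀ᵐ t ∂(volume.restrict (Icc 0 t₁)), HasDerivAt (fun s => (l s).2)
      ((0, 0, (l t).2.1 * (l t).1.2.2.sin - (l t).2.2.1 * (l t).1.2.2.cos) : Covector) t := by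
    filter_upwards [hae] with t ht
    rw [← hamVertical_hamiltonian 0 (u t)]
    exact ht.1.2
  have hzero : (fun t => (l t).2.2.2) =ᵐ[volume.restrict (Icc 0 t₁)] fun _ => 0 := by
    filter_upwards [hae] with t ht
    -- The Hamiltonian is affine in the control with slope `p₃`, and it has a maximum.
    have h1 := ht.2.1 (u t + 1)
    have h2 := ht.2.1 (u t - 1)
    rw [hamiltonian_eq, hamiltonian_eq] at h1 h2
    linarith
  have hp3 := Measure.eqOn_Icc_of_ae_eq volume ht₁.ne hzero
    (by simpa [uIcc_of_le ht₁.le] using hp3ac.continuousOn) continuousOn_const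
  have hp1 := eqOn_of_ae_hasDerivAt ht₁.le (h := fun _ => 0) hp1ac
    (absolutelyContinuousOnInterval_const (l 0).2.1 0 t₁)
    (by filter_upwards [hp'] with t ht using hasDerivAt_fst_comp ht)
    (.of_forall fun _ => hasDerivAt_const _ _) rfl
  have hp2 := eqOn_of_ae_hasDerivAt ht₁.le (h := fun _ => 0) hp2ac
    (absolutelyContinuousOnInterval_const (l 0).2.2.1 0 t₁)
    (by filter_upwards [hp'] with t ht using
          hasDerivAt_fst_comp (hasDerivAt_snd_comp ht))
    (.of_forall fun _ => hasDerivAt_const _ _) rfl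
  have hIoo : ∀ᵐ t ∂(volume.restrict (Icc 0 t₁)), t ∈ Ioo 0 t₁ := by
    rw [← restrict_Ioo_eq_restrict_Icc]
    exact ae_restrict_mem measurableSet_Ioo
  -- The derivative of `p₃ = 0` vanishes; by continuity this holds on the whole interval.
  have heq : (fun t => (l t).2.1 * (l t).1.2.2.sin - (l t).2.2.1 * (l t).1.2.2.cos)
      =ᵐ[volume.restrict (Icc 0 t₁)] fun _ => 0 := by
    filter_upwards [hp', hIoo] with t ht htI
    have hd := hasDerivAt_snd_comp (hasDerivAt_snd_comp ht)
    refine hd.unique ((hasDerivAt_const t (0 : ℝ)).congr_of_eventuallyEq ?_)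
    filter_upwards [Ioo_mem_nhds htI.1 htI.2] with s hs using hp3 ⟨hs.1.le, hs.2.le⟩
  have hac := (hp1ac.fun_mul (lipschitzWith_angle_sin.comp_absolutelyContinuousOnInterval
    hθac)).fun_sub (hp2ac.fun_mul (lipschitzWith_angle_cos.comp_absolutelyContinuousOnInterval
    hθac))
  have heqOn := Measure.eqOn_Icc_of_ae_eq volume ht₁.ne heq
    (by simpa [uIcc_of_le ht₁.le] using hac.continuousOn) continuousOn_const
  filter_upwards [hae, hp', hIoo] with t ht hpt htI
  have htI' : t ∈ Icc 0 t₁ := ⟨htI.1.le, htI.2.le⟩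
  have hv := ht.1.1.2.2
  rw [hamHorizontal_hamiltonian] at hv
  have hv' : HasDerivAt (fun s => ((l s).1.2.2 - (l t).1.2.2).toReal) (u t) t := by
    simpa [X₁, X₂] using hv
  -- Second differentiation: `u (p₁ cos θ + p₂ sin θ) = 0`, and the bracket cannot vanish together
  -- with `p₁ sin θ - p₂ cos θ`.
  have hd := ((hasDerivAt_fst_comp hpt).mul (hasDerivAt_angle_sin hv')).sub
    ((hasDerivAt_fst_comp (hasDerivAt_snd_comp hpt)).mul (hasDerivAt_angle_cos hv'))
  have h0 := hd.unique ((hasDerivAt_const t (0 : ℝ)).congr_of_eventuallyEq (by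
    filter_upwards [Ioo_mem_nhds htI.1 htI.2] with s hs using heqOn ⟨hs.1.le, hs.2.le⟩))
  have h1 := heqOn htI'
  have h3 := hp3 htI'
  beta_reduce at h1 h3
  have hcs := Real.Angle.cos_sq_add_sin_sq (l t).1.2.2
  set A := (l t).2.1
  set B := (l t).2.2.1
  set co := (l t).1.2.2.cos
  set si := (l t).1.2.2.sin
  have h0' : u t * (A * co + B * si) = 0 := by linear_combination h0
  rcases mul_eq_zero.1 h0' with hu0 | hAB
  · exact hu0
  · exfalso
    have hA : A = 0 := by linear_combination co * hAB + si * h1 - A * hcs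
    have hB : B = 0 := by linear_combination si * hAB - co * h1 - B * hcs
    exact ht.2.2 (Prod.ext rfl (Prod.ext hA (Prod.ext hB h3)))

theorem IsOptimalControl.memLp_top (ht₁ : 0 < t₁) (h : IsOptimalControl t₁ q₀ q₁ u) :
    MemLp u ⊤ (volume.restrict (Icc 0 t₁)) := by
  obtain ⟨q, h⟩ := h
  obtain ⟨ν, hext⟩ := h.satisfiesPMP ht₁.le
  rcases eq_or_lt_of_le hext.2.1 with rfl | hν
  · have h0 := IsAbnormalExtremalControl.ae_eq_zero ht₁ ⟨q, hext⟩
    exact (MemLp.zero (ε := ℝ)).ae_eq (h0.mono fun t ht => ht.symm)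
  · obtain ⟨-, -, l, hlac, -, hae⟩ := hext
    have hp3ac := absolutelyContinuousOnInterval_snd (absolutelyContinuousOnInterval_snd
      (absolutelyContinuousOnInterval_snd hlac))
    have hc : ContinuousOn (fun t => -(l t).2.2.2 / ν) (Icc 0 t₁) := by
      have := hp3ac.continuousOn
      rw [uIcc_of_le ht₁.le] at this
      exact this.neg.div_const ν
    refine (memLp_of_continuousOn hc ⊤).ae_eq ?_
    -- Comparing `u` with the vertex `-p₃ / ν` of the concave parabola `w ↦ w p₃ + ν w² / 2`.
    filter_upwards [hae] with t ht
    have h1 := ht.2.1 (-(l t).2.2.2 / ν)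
    rw [hamiltonian_eq, hamiltonian_eq] at h1
    set w := -(l t).2.2.2 / ν with hw
    have hp : (l t).2.2.2 = -(ν * w) := by rw [hw, mul_div_cancel₀ _ hν.ne, neg_neg]
    rw [hp] at h1
    have : -ν * (w - u t) ^ 2 ≤ 0 := by nlinarith
    have hsq : (w - u t) ^ 2 ≤ 0 := by nlinarith [sq_nonneg (w - u t)]
    have := pow_eq_zero_iff two_ne_zero |>.1 (le_antisymm hsq (sq_nonneg _))
    linarith

theorem exists_lipschitzOnWith_integral (ht₁ : 0 ≤ t₁)
    (hu : MemLp u ⊤ (volume.restrict (Icc 0 t₁))) :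
    ∃ K : ℝ≥0, LipschitzOnWith K (fun t => ∫ s in (0)..t, u s) (Icc 0 t₁) := by
  have hui : IntervalIntegrable u volume 0 t₁ :=
    (intervalIntegrable_iff_integrableOn_Icc_of_le ht₁).2 (hu.integrable le_top)
  have hbd : ∀ᵐ t, t ∈ Icc 0 t₁ →
      ‖u t‖ ≤ (eLpNorm u ⊤ (volume.restrict (Icc 0 t₁))).toReal := by
    rw [← ae_restrict_iff' measurableSet_Icc]
    filter_upwards [ae_le_eLpNormEssSup (f := u) (μ := volume.restrict (Icc 0 t₁))] with t ht
    rw [← toReal_enorm, eLpNorm_exponent_top]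
    refine ENNReal.toReal_mono ?_ ht
    rw [← eLpNorm_exponent_top]
    exact hu.2.ne
  have hsub : ∀ t ∈ Icc 0 t₁, IntervalIntegrable u volume 0 t := fun t ht =>
    hui.mono_set (uIcc_subset_uIcc left_mem_uIcc (by rwa [uIcc_of_le ht₁]))
  refine ⟨(eLpNorm u ⊤ (volume.restrict (Icc 0 t₁))).toNNReal,
    LipschitzOnWith.of_dist_le_mul fun s hs t ht => ?_⟩
  rw [dist_eq_norm, intervalIntegral.integral_interval_sub_left (hsub s hs) (hsub t ht),
    Real.dist_eq]
  refine intervalIntegral.norm_integral_le_of_norm_le_const_ae ?_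
  filter_upwards [hbd] with x hx hxI
  have h2 := uIoc_subset_uIcc hxI
  exact hx (uIcc_subset_Icc ht hs h2)

theorem IsOptimalSolution.exists_lipschitzOnWith (ht₁ : 0 < t₁)
    (h : IsOptimalSolution t₁ q₀ q₁ u q) : ∃ K : ℝ≥0, LipschitzOnWith K q (Icc 0 t₁) := by
  have hu := IsOptimalControl.memLp_top ht₁ ⟨q, h⟩
  obtain ⟨⟨htraj, hq0, -⟩, -⟩ := h
  have hui := htraj.1.intervalIntegrable ht₁.le
  have hqE := htraj.eqOn_trajectoryFrom ht₁.le
  rw [hq0] at hqE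
  have hangle := continuousOn_angleLift (q₀ := q₀) ht₁.le hui
  have shift : ∀ (c : ℝ) {K : ℝ≥0} {g : ℝ → ℝ}, LipschitzOnWith K g (Icc 0 t₁) →
      LipschitzOnWith K (fun t => c + g t) (Icc 0 t₁) := fun c K g hg =>
    LipschitzOnWith.of_dist_le_mul fun s hs t ht => by
      simpa using hg.dist_le_mul s hs t ht
  obtain ⟨K₁, h1⟩ := exists_lipschitzOnWith_integral ht₁.le
    (memLp_of_continuousOn (Real.continuous_cos.comp_continuousOn hangle) ⊤)
  obtain ⟨K₂, h2⟩ := exists_lipschitzOnWith_integral ht₁.le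
    (memLp_of_continuousOn (Real.continuous_sin.comp_continuousOn hangle) ⊤)
  obtain ⟨K₃, h3⟩ := exists_lipschitzOnWith_integral ht₁.le hu
  have h3' := (lipschitzWith_coe.lipschitzOnWith (s := univ)).comp (shift q₀.2.2.toReal h3)
    (mapsTo_univ _ _)
  have hall := (shift q₀.1 h1).prodMk ((shift q₀.2.1 h2).prodMk h3')
  exact ⟨_, fun s hs t ht => by
    rw [hqE hs, hqE ht]
    exact hall hs ht⟩

/-! ### Existence of optimal controls -/

/-- The direct method: a nonempty weakly sequentially closed set in a separable Hilbert space has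
an element of least norm. -/
theorem exists_norm_le_of_weakly_seqClosed {H : Type*} [NormedAddCommGroup H]
    [InnerProductSpace ℝ H] [CompleteSpace H] [TopologicalSpace.SeparableSpace H]
    {S : Set H} (hne : S.Nonempty)
    (hS : ∀ (x : ℕ → H) (y : H), (∀ n, x n ∈ S) →
      (∀ w, Tendsto (fun n => inner ℝ (x n) w) atTop (𝓝 (inner ℝ y w))) → y ∈ S) :
    ∃ y ∈ S, ∀ x ∈ S, ‖y‖ ≤ ‖x‖ := by
  set m : ℝ := sInf (norm '' S) with hm
  have hbdd : BddBelow (norm '' S) := ⟨0, by rintro _ ⟨x, -, rfl⟩; exact norm_nonneg x⟩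
  have hle : ∀ x ∈ S, m ≤ ‖x‖ := fun x hx => csInf_le hbdd (mem_image_of_mem _ hx)
  obtain ⟨r, hanti, hr, hrS⟩ := exists_seq_tendsto_sInf (hne.image norm) hbdd
  choose x hxS hxr using hrS
  have hball : ∀ n, StrongDual.toWeakDual (InnerProductSpace.toDual ℝ H (x n)) ∈
      WeakDual.toStrongDual ⁻¹' Metric.closedBall (0 : StrongDual ℝ H) (r 0) := fun n => by
    simp only [mem_preimage, mem_closedBall_zero_iff]
    change ‖InnerProductSpace.toDual ℝ H (x n)‖ ≤ r 0
    rw [LinearIsometryEquiv.norm_map, hxr]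
    exact hanti (Nat.zero_le n)
  obtain ⟨φ, -, k, hk, hφ⟩ := WeakDual.isSeqCompact_closedBall ℝ H 0 (r 0) hball
  set y : H := (InnerProductSpace.toDual ℝ H).symm (WeakDual.toStrongDual φ) with hy
  have hweak : ∀ w, Tendsto (fun n => inner ℝ (x (k n)) w) atTop (𝓝 (inner ℝ y w)) := fun w => by
    have h := ((WeakDual.eval_continuous (𝕜 := ℝ) w).tendsto φ).comp hφ
    rw [hy, InnerProductSpace.toDual_symm_apply]
    exact h
  refine ⟨y, hS _ y (fun n => hxS (k n)) hweak, fun z hz => ?_⟩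
  -- Weak lower semicontinuity of the norm, tested against `y` itself.
  have hlim : ‖y‖ * ‖y‖ ≤ m * ‖y‖ := by
    rw [← real_inner_self_eq_norm_mul_norm]
    refine le_of_tendsto_of_tendsto (hweak y) ((hr.comp hk.tendsto_atTop).mul_const ‖y‖)
      (.of_forall fun n => ?_)
    refine (real_inner_le_norm _ _).trans ?_
    rw [hxr]
    rfl
  rcases eq_or_lt_of_le (norm_nonneg y) with h0 | h0
  · rw [← h0]
    exact norm_nonneg z
  · exact (le_of_mul_le_mul_right hlim h0).trans (hle z hz)

/-- The endpoint map is weakly sequentially continuous: the lifted angles converge pointwise and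
the plane coordinates by dominated convergence. -/
theorem tendsto_trajectoryFrom (ht₁ : 0 ≤ t₁) {x : ℕ → ControlSpace t₁} {y : ControlSpace t₁}
    (h : ∀ w, Tendsto (fun n => inner ℝ (x n) w) atTop (𝓝 (inner ℝ y w))) :
    Tendsto (fun n => trajectoryFrom q₀ (x n) t₁) atTop (𝓝 (trajectoryFrom q₀ y t₁)) := by
  have hlift : ∀ t ∈ Icc 0 t₁,
      Tendsto (fun n => angleLift q₀ (x n) t) atTop (𝓝 (angleLift q₀ y t)) := fun t ht => by
    simp only [angleLift_coe _ ht, real_inner_comm _ (primitiveVec t₁ t)]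
    exact (h _).const_add _
  have hint : ∀ f : ℝ → ℝ, Continuous f → (∀ s, |f s| ≤ 1) →
      Tendsto (fun n => ∫ t in (0)..t₁, f (angleLift q₀ (x n) t)) atTop
        (𝓝 (∫ t in (0)..t₁, f (angleLift q₀ y t))) := fun f hf hb => by
    refine intervalIntegral.tendsto_integral_filter_of_dominated_convergence (fun _ => 1)
      (.of_forall fun n => ?_) (.of_forall fun n => .of_forall fun t _ => hb _)
      intervalIntegrable_const (.of_forall fun t ht => ?_)
    · exact (intervalIntegrable_comp_angleLift ht₁
        ((isAdmissibleControl_coe (x n)).intervalIntegrable ht₁) hf).def'.aestronglyMeasurable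
    · rw [uIoc_of_le ht₁] at ht
      exact (hf.tendsto _).comp (hlift t ⟨ht.1.le, ht.2⟩)
  exact ((hint _ Real.continuous_cos Real.abs_cos_le_one).const_add _).prodMk_nhds
    (((hint _ Real.continuous_sin Real.abs_sin_le_one).const_add _).prodMk_nhds
      ((lipschitzWith_coe.continuous.tendsto _).comp (hlift t₁ ⟨ht₁, le_rfl⟩)))

theorem exists_isOptimalControl (ht₁ : 0 ≤ t₁) (h : q₁ ∈ attainableSet q₀ t₁) :
    ∃ u, IsOptimalControl t₁ q₀ q₁ u := by
  have hend : t₁ ∈ Icc 0 t₁ := ⟨ht₁, le_rfl⟩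
  have hmem : ∀ {u q}, Connects t₁ q₀ q₁ u q → ∃ w : ControlSpace t₁,
      w =ᵐ[volume.restrict (Icc 0 t₁)] u ∧ trajectoryFrom q₀ w t₁ = q₁ := fun {u q} hc => by
    have hu : IsAdmissibleControl t₁ u := hc.1.1
    have he := MemLp.coeFn_toLp hu
    exact ⟨MemLp.toLp u hu, he, by rw [trajectoryFrom_congr he hend, hc.trajectoryFrom_eq ht₁]⟩
  obtain ⟨u, q, hc⟩ := h
  obtain ⟨w, -, hw⟩ := hmem hc
  have : Fact ((2 : ENNReal) ≠ ⊤) := ⟨ENNReal.ofNat_ne_top⟩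
  obtain ⟨y, hy, hmin⟩ := exists_norm_le_of_weakly_seqClosed
    (S := {w : ControlSpace t₁ | trajectoryFrom q₀ w t₁ = q₁}) ⟨w, hw⟩ fun x y hx hxy =>
      tendsto_nhds_unique ((tendsto_trajectoryFrom ht₁ hxy).congr hx) tendsto_const_nhds
  refine ⟨y, _, connects_trajectoryFrom ht₁ (isAdmissibleControl_coe y) hy, fun u' q' hc' => ?_⟩
  obtain ⟨w', hw', hwq⟩ := hmem hc'
  rw [← energy_congr ht₁ hw', energy_coe ht₁, energy_coe ht₁]
  have := hmin w' hwq
  gcongr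

end EulerElastica

end

theorem mainTheorem5 (t₁ : ℝ) (ht₁ : 0 < t₁) (q₀ q₁ : EulerElastica.State)
    (hq₁ : q₁ ∈ EulerElastica.attainableSet q₀ t₁) :
    (∃ u : ℝ → ℝ, EulerElastica.IsOptimalControl t₁ q₀ q₁ u) ∧
    (∀ (u : ℝ → ℝ) (q : ℝ → EulerElastica.State),
      EulerElastica.IsOptimalSolution t₁ q₀ q₁ u q → EulerElastica.SatisfiesPMP t₁ u q) ∧
    (∀ u : ℝ → ℝ, EulerElastica.IsAbnormalExtremalControl t₁ u →
      ∀ᵐ t ∂(volume.restrict (Icc 0 t₁)), u t = 0) ∧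
    (∀ u : ℝ → ℝ, EulerElastica.IsOptimalControl t₁ q₀ q₁ u →
      MemLp u ⊤ (volume.restrict (Icc 0 t₁))) ∧
    (∀ (u : ℝ → ℝ) (q : ℝ → EulerElastica.State),
      EulerElastica.IsOptimalSolution t₁ q₀ q₁ u q →
        ∃ K : NNReal, LipschitzOnWith K q (Icc 0 t₁)) :=
  ⟨EulerElastica.exists_isOptimalControl ht₁.le hq₁,
    fun _ _ h => h.satisfiesPMP ht₁.le,
    fun _ h => h.ae_eq_zero ht₁,
    fun _ h => h.memLp_top ht₁,
    fun _ _ h => h.exists_lipschitzOnWith ht₁⟩
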